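/- Let $\mathcal H$ be a real Hilbert space with closed unit ball $\mathbb B$, let $T>0$, and write $d_S(x)=\inf_{z\in S}\|x-z\|$. For a set $S\subset\mathcal H$ and $x\in S$, the Clarke tangent cone $T(S;x)$ is the set of $d\in\mathcal H$ such that for every sequence $(u_n)$ in $S$ with $u_n\to x$ and every sequence $\tau_n>0$ with $\tau_n\to0$ there are $d_n\to d$ with $u_n+\tau_n d_n\in S$ for all $n$. The Clarke normal cone is $N(S;x)=\{v:\langle v,d\rangle\le 0\ \ \forall d\in T(S;x)\}$ if $x\in S$, and $N(S;x)=\emptyset$ if $x\notin S$. For $\varepsilon>0$ put $\operatorname{proj}^{\varepsilon}_S(x)=\{z\in S:\|x-z\|^2<d_S^2(x)+\varepsilon\}$, and for $\varepsilon,\eta>0$ put $\operatorname{proj}^{\varepsilon,\eta}_S(x)=\{z\in S_\eta:\|x-z\|^2<d_S^2(x)+\varepsilon\}$, where $S_\eta$ is any closed set with $S\subset S_\eta\subset S+\eta\mathbb B$ (the choice of $S_\eta$ may vary from one use to the next). Let $C\subset\mathcal H$ be ball-compact, i.e. $C\cap r\mathbb B$ is compact for all $r>0$ (in particular $C$ is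 closed), and let $x_0\in C$. Let $F\colon[0,T]\times\mathcal H\rightrightarrows\mathcal H$ have nonempty, closed and convex values, and assume: - $(H_1)$ for every $t\in[0,T]$, $F(t,\cdot)$ is upper semicontinuous from $\mathcal H$ into $\mathcal H$ with the weak topology, i.e. $\{x: F(t,x)\cap D\ne\emptyset\}$ is closed for every weakly closed $D\subset\mathcal H$; - $(H_2)$ there is a Lipschitz continuous $h\colon\mathcal H\to[0,\infty)$ such that for every $x\in\mathcal H$, $d_{F(t,x)}(0)\le h(x)$ for a.e. $t\in[0,T]$; - $(H_3)$ there are $\gamma>0$ and $f\colon[0,T]\times\mathcal H\to\mathcal H$ with $f(t,x)\in\operatorname{proj}^{\gamma}_{F(t,x)}(0)$ for all $(t,x)$ and with $f(\cdot,x)$ (strongly Lebesgue) measurable for all $x\in\mathcal H$. For $n\ge1$ let $\mu_n=T/n$ and $t^n_k=k\mu_n$ $(0\le k\le n)$, and let $\varepsilon_n,\eta_n>0$ satisfy $\varepsilon_n/\mu_n^2\to0$ and $\eta_n/\mu_n\to0$. For $n\ge1$ let $x^n_0=x_0$ and $$x^n_{k+1}\in\operatorname{proj}^{\varepsilon_n,\eta_n}_{C}\Big(x^n_k+\int_{t^n_k}^{t^n_{k+1}}f(s,x^n_k)\,ds\Big),\qquad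 0\le k\le n-1,$$ and let $x_n\colon[0,T]\to\mathcal H$ be given by $x_n(0)=x_0$ and, for $t\in\,]t^n_k,t^n_{k+1}]$, $$x_n(t)=x^n_k+\frac{t-t^n_k}{\mu_n}\Big(x^n_{k+1}-x^n_k-\int_{t^n_k}^{t^n_{k+1}}f(s,x^n_k)\,ds\Big)+\int_{t^n_k}^{t}f(s,x^n_k)\,ds .$$ Then a subsequence of $(x_n)$ converges uniformly on $[0,T]$ to a Lipschitz continuous function $x\colon[0,T]\to\mathcal H$ which solves $$\dot x(t)\in -N(C;x(t))+F(t,x(t))\ \text{ for a.e. } t\in[0,T],\qquad x(0)=x_0,$$ and which satisfies $\|\dot x(t)\|\le 2\big(h(x(t))+\sqrt\gamma\big)$ for a.e. $t\in[0,T]$. -/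

import Mathlib

open Set Filter Topology MeasureTheory
open scoped Pointwise NNReal

namespace Sweeping

variable {H : Type*} [NormedAddCommGroup H] [InnerProductSpace ℝ H]

/-- `S` is ball compact: `S ∩ r𝔹` is compact for every `r > 0`. -/
def IsBallCompact (S : Set H) : Prop :=
  ∀ r : ℝ, 0 < r → IsCompact (S ∩ Metric.closedBall 0 r)

/-- The Clarke tangent cone `T(S; x)`, through sequences. -/
def clarkeTangentCone (S : Set H) (x : H) : Set H :=
  {d | ∀ (u : ℕ → H) (τ : ℕ → ℝ), (∀ n, u n ∈ S) → Tendsto u atTop (𝓝 x) →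
    (∀ n, 0 < τ n) → Tendsto τ atTop (𝓝 0) →
    ∃ w : ℕ → H, Tendsto w atTop (𝓝 d) ∧ ∀ n, u n + τ n • w n ∈ S}

/-- The Clarke normal cone `N(S; x)`: the negative polar of the Clarke tangent cone if `x ∈ S`,
and the empty set otherwise. -/
def clarkeNormalCone (S : Set H) (x : H) : Set H :=
  {v | x ∈ S ∧ ∀ d ∈ clarkeTangentCone S x, inner ℝ v d ≤ 0}

/-- The `ε`-approximate projections of `x` onto `S`. -/
def epsProj (S : Set H) (ε : ℝ) (x : H) : Set H :=
  {z | z ∈ S ∧ ‖x - z‖ ^ 2 < Metric.infDist x S ^ 2 + ε}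

/-- The `ε`-`η` approximate projections of `x` onto `S`, for an arbitrary choice of the closed
set `S'` with `S ⊆ S' ⊆ S + η𝔹` in which they are sought. -/
def epsEtaProj (S : Set H) (ε η : ℝ) (x : H) : Set H :=
  {z | ∃ S' : Set H, IsClosed S' ∧ S ⊆ S' ∧ S' ⊆ S + Metric.closedBall (0 : H) η ∧
    z ∈ S' ∧ ‖x - z‖ ^ 2 < Metric.infDist x S ^ 2 + ε}

/-- Upper semicontinuity of a set-valued map from `H` (norm topology) into `H` with its weak
topology: the preimage `{x | G x ∩ D ≠ ∅}` of every weakly closed set `D` is closed. -/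
def IsWeaklyUSC (G : H → Set H) : Prop :=
  ∀ D : Set (WeakSpace ℝ H), IsClosed D →
    IsClosed {x : H | (G x ∩ toWeakSpace ℝ H ⁻¹' D).Nonempty}

/-- The node `t_k^n = k T / n` of the uniform partition of `[0, T]` with step `T / n`. -/
noncomputable def gridPt (T : ℝ) (n k : ℕ) : ℝ := k * (T / n)

/-- The nodes `y 0, …, y n` and the interpolation `x : [0, T] → H` are generated by the inexact
catching-up algorithm with `n` steps for the fixed set `C`, the selection `f`, the initial point
`x₀` and the tolerances `ε`, `η`. -/
structure IsInexactCatchingUp (C : Set H) (f : ℝ → H → H) (T : ℝ) (x₀ : H) (ε η : ℝ) (n : ℕ)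
    (y : ℕ → H) (x : ℝ → H) : Prop where
  node_zero : y 0 = x₀
  node_succ : ∀ k < n, y (k + 1) ∈
    epsEtaProj C ε η (y k + ∫ s in (gridPt T n k)..(gridPt T n (k + 1)), f s (y k))
  traj_zero : x 0 = x₀
  traj : ∀ k < n, ∀ t ∈ Ioc (gridPt T n k) (gridPt T n (k + 1)),
    x t = y k
      + ((t - gridPt T n k) / (T / n)) •
          (y (k + 1) - y k - ∫ s in (gridPt T n k)..(gridPt T n (k + 1)), f s (y k))
      + ∫ s in (gridPt T n k)..t, f s (y k)

/-- `x` is a Lipschitz solution on `[0, T]` of `ẋ(t) ∈ -N(C; x(t)) + F(t, x(t))` for almost every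
`t`, with `x(0) = x₀`. -/
structure IsLipschitzSolution (C : Set H) (F : ℝ → H → Set H) (T : ℝ) (x₀ : H)
    (x : ℝ → H) : Prop where
  lipschitz : ∃ K : ℝ≥0, LipschitzOnWith K x (Icc 0 T)
  initial : x 0 = x₀
  inclusion : ∀ᵐ t ∂(volume.restrict (Icc 0 T)),
    DifferentiableAt ℝ x t ∧ deriv x t ∈ -clarkeNormalCone C (x t) + F t (x t)

end Sweeping

/-!
Write `f_n(t) = f(t, y_k)` and `z_n(t) = (y_k + ∫ f(s, y_k) ds - y_{k+1}) / μ_n` on the step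
`]t_k, t_{k+1}]` of the run with `n` steps (`pertStep`, `normalStep`). The interpolation is the
primitive of `f_n - z_n`. Comparing the approximate projection `y_{k+1}` with a point of `C` near
`y_k` gives `‖z_n(t)‖ ≤ h(y_k) + √γ + o(1)`, and a discrete Grönwall estimate then bounds everything
uniformly. Hence the interpolations are uniformly Lipschitz and approach a compact subset of `C`,
and Arzelà–Ascoli provides the limit `X`.

To pass to the limit in the velocities, weak convergence is replaced by the *tail hull* of a
sequence, the intersection of the closed convex hulls of its tails. In a Hilbert space the tail hull of a
bounded sequence is nonempty (`tailHull_nonempty`); elements of the tail hull in `L²` lie almost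
everywhere in the tail hull of the values (`ae_mem_tailHull`); and a closed convex condition that
holds eventually along a sequence holds on its tail hull (`mem_of_mem_tailHull`). Applied to the
pairs `(f_n, z_n)` this gives, for almost every `t`, a pair `(ξ, z)` in the tail hull of
`(f_n(t), z_n(t))` with `X'(t) = ξ - z` (`ae_exists_mem_tailHull_hasDerivAt`); in particular `X` is
differentiable almost everywhere, although `H` may have infinite dimension. It remains to read off
closed convex conditions at such a `t`.

* `ξ ∈ F(t, X(t))`, by separation and weak upper semicontinuity
  (`mem_of_mem_tailHull_of_isWeaklyUSC`).
* `z ∈ N(C; X(t))`. For a Clarke tangent direction `d` at `X(t)`, choose `c_n ∈ C` within `η_n` of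
  the node `y_{k+1}` and `d_n → d` with `c_n + τ_n d_n ∈ C`. The approximate minimality of `y_{k+1}`
  against this competitor bounds `⟨z_n(t), d_n⟩` by terms that vanish for `τ_n = μ_n σ_n` with
  `σ_n² = η_n / μ_n + ε_n / μ_n²` (`eventually_inner_le_of_mem_clarkeTangentCone`).
* `‖ξ - z‖ ≤ 2 (h(X(t)) + √γ)`, since `‖f_n(t) - z_n(t)‖ ≤ 2 (h(y_k) + √γ) + o(1)` and
  `y_k → X(t)`.
-/

namespace Sweeping

/-! ### Closed convex hulls of tails -/

/-- The intersection of the closed convex hulls of the tails of a sequence. It plays the part of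
a set of weak limit points: a closed convex condition that holds along the sequence eventually is
inherited by every element. -/
def tailHull {E : Type*} [NormedAddCommGroup E] [NormedSpace ℝ E] (g : ℕ → E) : Set E :=
  ⋂ n, closure (convexHull ℝ (g '' Ici n))

theorem mem_of_mem_tailHull {E : Type*} [NormedAddCommGroup E] [NormedSpace ℝ E] {g : ℕ → E}
    {p : E} (hp : p ∈ tailHull g) {Q : Set E} (hQ : Convex ℝ Q) (hQc : IsClosed Q)
    (hg : ∀ᶠ n in atTop, g n ∈ Q) : p ∈ Q := by
  obtain ⟨N, hN⟩ := eventually_atTop.1 hg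
  have hp' := mem_iInter.1 hp N
  refine closure_minimal (convexHull_min ?_ hQ) hQc hp'
  rintro _ ⟨m, hm, rfl⟩
  exact hN m hm

theorem map_mem_tailHull {E G : Type*} [NormedAddCommGroup E] [NormedSpace ℝ E]
    [NormedAddCommGroup G] [NormedSpace ℝ G] (D : E →L[ℝ] G) {g : ℕ → E} {p : E}
    (hp : p ∈ tailHull g) : D p ∈ tailHull fun n => D (g n) := by
  refine mem_iInter.2 fun n => ?_
  have h1 := image_closure_subset_closure_image D.continuous
    (mem_image_of_mem D (mem_iInter.1 hp n))
  have h2 : D '' convexHull ℝ (g '' Ici n) = convexHull ℝ ((fun m => D (g m)) '' Ici n) := by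
    have := (D : E →ₗ[ℝ] G).image_convexHull (g '' Ici n)
    rw [image_image] at this
    exact this
  rwa [h2] at h1

/-- If the values of a continuous linear functional along a sequence tend to `a`, then it takes the
value `a` on the whole tail hull. -/
theorem apply_eq_of_mem_tailHull {E : Type*} [NormedAddCommGroup E] [NormedSpace ℝ E]
    {g : ℕ → E} {p : E} (hp : p ∈ tailHull g) (l : E →L[ℝ] ℝ) {a : ℝ}
    (hl : Tendsto (fun n => l (g n)) atTop (𝓝 a)) : l p = a := by
  refine eq_of_forall_dist_le fun ε hε => ?_
  have : p ∈ l ⁻¹' Metric.closedBall a ε := by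
    refine mem_of_mem_tailHull hp ?_ ?_ ?_
    · exact (convex_closedBall a ε).linear_preimage (l : E →ₗ[ℝ] ℝ)
    · exact Metric.isClosed_closedBall.preimage l.continuous
    · exact hl.eventually (Metric.closedBall_mem_nhds a hε)
  exact this

/-- In a Hilbert space the tail hull of a bounded sequence is nonempty: the elements of minimal norm
of the closed convex hulls of the tails form a Cauchy sequence, and its limit lies in all of these
hulls. -/
theorem tailHull_nonempty {E : Type*} [NormedAddCommGroup E] [InnerProductSpace ℝ E]
    [CompleteSpace E] (g : ℕ → E) (R : ℝ) (hR : ∀ n, ‖g n‖ ≤ R) : (tailHull g).Nonempty := by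
  set K : ℕ → Set E := fun n => closure (convexHull ℝ (g '' Ici n)) with hK
  have hKc : ∀ n, IsClosed (K n) := fun n => isClosed_closure
  have hKconv : ∀ n, Convex ℝ (K n) := fun n => (convex_convexHull ℝ _).closure
  have hKanti : ∀ n m, n ≤ m → K m ⊆ K n := fun n m h =>
    closure_mono (convexHull_mono (image_mono (Ici_subset_Ici.2 h)))
  have hKne : ∀ n, (K n).Nonempty := fun n =>
    ⟨g n, subset_closure (subset_convexHull ℝ _ ⟨n, mem_Ici.2 le_rfl, rfl⟩)⟩
  have hKbd : ∀ n, K n ⊆ Metric.closedBall 0 R := by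
    intro n
    refine closure_minimal (convexHull_min ?_ (convex_closedBall 0 R)) Metric.isClosed_closedBall
    rintro _ ⟨m, -, rfl⟩
    simpa using hR m
  choose v hvK hv using fun n =>
    exists_norm_eq_iInf_of_complete_convex (hKne n) (hKc n).isComplete (hKconv n) 0
  have hv' : ∀ n, ∀ w ∈ K n, ‖v n‖ ^ 2 ≤ inner ℝ (v n) w := by
    intro n w hw
    have := (norm_eq_iInf_iff_real_inner_le_zero (hKconv n) (hvK n)).1 (hv n) w hw
    rw [zero_sub, inner_neg_left, inner_sub_right, real_inner_self_eq_norm_sq] at this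
    linarith
  have hdist : ∀ n m, n ≤ m → ‖v m - v n‖ ^ 2 ≤ ‖v m‖ ^ 2 - ‖v n‖ ^ 2 := by
    intro n m h
    have h1 := hv' n (v m) (hKanti n m h (hvK m))
    have h2 := norm_sub_sq_real (v m) (v n)
    rw [real_inner_comm] at h2
    linarith
  have hmono : Monotone fun n => ‖v n‖ ^ 2 := by
    intro n m h
    have := hdist n m h
    have := sq_nonneg ‖v m - v n‖
    simp only
    linarith
  have hbdd : BddAbove (range fun n => ‖v n‖ ^ 2) := by
    refine ⟨R ^ 2, ?_⟩
    rintro _ ⟨n, rfl⟩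
    have : ‖v n‖ ≤ R := by simpa using hKbd n (hvK n)
    exact pow_le_pow_left₀ (norm_nonneg _) this 2
  have hcauchy : CauchySeq v := by
    have h1 : CauchySeq fun n => ‖v n‖ ^ 2 := (tendsto_atTop_ciSup hmono hbdd).cauchySeq
    rw [Metric.cauchySeq_iff'] at h1 ⊢
    intro ε hε
    obtain ⟨N, hN⟩ := h1 (ε ^ 2) (by positivity)
    refine ⟨N, fun n hn => ?_⟩
    have h2 := hN n hn
    rw [Real.dist_eq] at h2
    have h3 := hdist N n hn
    rw [dist_eq_norm]
    exact lt_of_pow_lt_pow_left₀ 2 hε.le (h3.trans_lt ((le_abs_self _).trans_lt h2))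
  obtain ⟨p, hp⟩ := cauchySeq_tendsto_of_complete hcauchy
  refine ⟨p, mem_iInter.2 fun n => ?_⟩
  refine (hKc n).mem_of_tendsto hp ?_
  filter_upwards [eventually_ge_atTop n] with m hm
  exact hKanti n m hm (hvK m)

/-- Elements of the tail hull of a sequence of `L²` functions lie pointwise almost everywhere in the
tail hulls of the values. -/
theorem ae_mem_tailHull {α E : Type*} [MeasurableSpace α] {μ : Measure α} [NormedAddCommGroup E]
    [NormedSpace ℝ E] {G : ℕ → Lp E 2 μ} {p : Lp E 2 μ} (hp : p ∈ tailHull G)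
    {g : ℕ → α → E} (hg : ∀ n, G n =ᵐ[μ] g n) :
    ∀ᵐ t ∂μ, p t ∈ tailHull fun n => g n t := by
  have key : ∀ n, ∀ᵐ t ∂μ, p t ∈ closure (convexHull ℝ ((fun m => g m t) '' Ici n)) := by
    intro n
    obtain ⟨w, hw, hwp⟩ := mem_closure_iff_seq_limit.1 (mem_iInter.1 hp n)
    have hconv : convexHull ℝ (G '' Ici n) ⊆
        {w : Lp E 2 μ | ∀ᵐ t ∂μ, w t ∈ convexHull ℝ ((fun m => g m t) '' Ici n)} := by
      refine convexHull_min ?_ ?_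
      · rintro _ ⟨m, hm, rfl⟩
        filter_upwards [hg m] with t ht
        rw [ht]
        exact subset_convexHull ℝ _ ⟨m, hm, rfl⟩
      · intro a ha b hb r s hr hs hrs
        filter_upwards [ha, hb, Lp.coeFn_add (r • a) (s • b), Lp.coeFn_smul r a,
          Lp.coeFn_smul s b] with t hta htb h1 h2 h3
        rw [h1, Pi.add_apply, h2, h3]
        exact convex_convexHull ℝ _ hta htb hr hs hrs
    obtain ⟨ns, -, hns⟩ := (tendstoInMeasure_of_tendsto_Lp hwp).exists_seq_tendsto_ae
    have hall : ∀ᵐ t ∂μ, ∀ j, w j t ∈ convexHull ℝ ((fun m => g m t) '' Ici n) :=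
      ae_all_iff.2 fun j => hconv (hw j)
    filter_upwards [hns, hall] with t ht1 ht2
    exact mem_closure_of_tendsto ht1 (Eventually.of_forall fun j => ht2 (ns j))
  filter_upwards [ae_all_iff.2 key] with t ht
  exact mem_iInter.2 ht

/-! ### A compactness theorem for Lipschitz curves -/

/-- Uniformly Lipschitz curves on `[0, T]` that approach a compact set uniformly have a uniformly
convergent subsequence. -/
theorem exists_tendstoUniformlyOn_of_lipschitz {E : Type*} [NormedAddCommGroup E]
    {T : ℝ} (hT : 0 ≤ T) {A : Set E} (hA : IsCompact A) {K : ℝ≥0} {x : ℕ → ℝ → E}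
    (hx : ∀ n, LipschitzOnWith K (x n) (Icc 0 T)) {δ : ℕ → ℝ} (hδ : Tendsto δ atTop (𝓝 0))
    (hxA : ∀ n, ∀ t ∈ Icc 0 T, ∃ a ∈ A, dist (x n t) a ≤ δ n) [CompleteSpace E] :
    ∃ (φ : ℕ → ℕ) (X : ℝ → E), StrictMono φ ∧
      TendstoUniformlyOn (fun j => x (φ j)) X atTop (Icc 0 T) := by
  set S : Set E := A ∪ ⋃ n, x n '' Icc 0 T with hS
  have hStb : TotallyBounded S := by
    rw [Metric.totallyBounded_iff]
    intro ε hε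
    obtain ⟨N, hN⟩ := eventually_atTop.1 (hδ.eventually (gt_mem_nhds (half_pos hε)))
    have hcomp : IsCompact (A ∪ ⋃ n ∈ Finset.range N, x n '' Icc 0 T) :=
      hA.union ((Finset.range N).isCompact_biUnion fun n _ =>
        isCompact_Icc.image_of_continuousOn (hx n).continuousOn)
    obtain ⟨s, hs, hcov⟩ := Metric.totallyBounded_iff.1 hcomp.totallyBounded (ε / 2) (half_pos hε)
    refine ⟨s, hs, ?_⟩
    rintro z (hz | hz)
    · obtain ⟨c, hc, hzc⟩ := mem_iUnion₂.1 (hcov (Or.inl hz))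
      exact mem_iUnion₂.2 ⟨c, hc, Metric.ball_subset_ball (by linarith) hzc⟩
    · obtain ⟨n, t, ht, rfl⟩ := mem_iUnion.1 hz
      by_cases hn : n < N
      · obtain ⟨c, hc, hzc⟩ := mem_iUnion₂.1
          (hcov (Or.inr (mem_iUnion₂.2 ⟨n, Finset.mem_range.2 hn, t, ht, rfl⟩)))
        exact mem_iUnion₂.2 ⟨c, hc, Metric.ball_subset_ball (by linarith) hzc⟩
      · obtain ⟨a, ha, hda⟩ := hxA n t ht
        obtain ⟨c, hc, hzc⟩ := mem_iUnion₂.1 (hcov (Or.inl ha))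
        refine mem_iUnion₂.2 ⟨c, hc, ?_⟩
        rw [Metric.mem_ball] at hzc ⊢
        have := hN n (not_lt.1 hn)
        have := dist_triangle (x n t) a c
        linarith
  have hScomp : IsCompact (closure S) := hStb.closure.isCompact_of_isClosed isClosed_closure
  have hres : ∀ n, LipschitzWith K ((Icc 0 T).domRestrict (x n)) := fun n => (hx n).to_restrict
  let G : ℕ → BoundedContinuousFunction (Icc (0 : ℝ) T) E := fun n =>
    BoundedContinuousFunction.mkOfCompact ⟨(Icc 0 T).domRestrict (x n), (hres n).continuous⟩
  have hcl := BoundedContinuousFunction.arzela_ascoli (closure S) hScomp (range G)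
    (by
      rintro _ t ⟨n, rfl⟩
      exact subset_closure (Or.inr (mem_iUnion.2 ⟨n, t, t.2, rfl⟩)))
    (by
      refine (LipschitzWith.uniformEquicontinuous _ K ?_).equicontinuous
      rintro ⟨_, n, rfl⟩
      exact hres n)
  obtain ⟨Y, -, φ, hφ, hlim⟩ := hcl.tendsto_subseq fun n => subset_closure (mem_range_self n)
  refine ⟨φ, fun t => Y (projIcc 0 T hT t), hφ, ?_⟩
  have hu := BoundedContinuousFunction.tendsto_iff_tendstoUniformly.1 hlim
  rw [Metric.tendstoUniformlyOn_iff]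
  rw [Metric.tendstoUniformly_iff] at hu
  intro ε hε
  filter_upwards [hu ε hε] with j hj t ht
  have := hj ⟨t, ht⟩
  rw [projIcc_of_mem hT ht]
  exact this

section Runs

variable {H : Type*} [NormedAddCommGroup H] [InnerProductSpace ℝ H]

/-! ### The uniform grid -/

theorem gridPt_zero (T : ℝ) (n : ℕ) : gridPt T n 0 = 0 := by simp [gridPt]

theorem gridPt_self (T : ℝ) {n : ℕ} (hn : 1 ≤ n) : gridPt T n n = T := by
  have : (n : ℝ) ≠ 0 := by positivity
  rw [gridPt]
  field_simp

theorem gridPt_succ (T : ℝ) (n k : ℕ) : gridPt T n (k + 1) = gridPt T n k + T / n := by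
  rw [gridPt, gridPt]
  push_cast
  ring

theorem gridPt_mono {T : ℝ} (hT : 0 ≤ T) (n : ℕ) {k l : ℕ} (hkl : k ≤ l) :
    gridPt T n k ≤ gridPt T n l := by
  have : (k : ℝ) ≤ l := by exact_mod_cast hkl
  exact mul_le_mul_of_nonneg_right this (by positivity)

theorem gridPt_nonneg {T : ℝ} (hT : 0 ≤ T) (n k : ℕ) : 0 ≤ gridPt T n k := by
  rw [gridPt]
  positivity

theorem gridPt_le {T : ℝ} (hT : 0 ≤ T) {n k : ℕ} (hn : 1 ≤ n) (hk : k ≤ n) : gridPt T n k ≤ T :=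
  (gridPt_mono hT n hk).trans_eq (gridPt_self T hn)

/-- The index `k` of the step `]t_k, t_{k+1}]` of the uniform grid that contains a positive
time `t`. -/
noncomputable def stepIdx (T : ℝ) (n : ℕ) (t : ℝ) : ℕ := ⌈t / (T / n)⌉₊ - 1

theorem stepIdx_eq {T : ℝ} (hT : 0 < T) {n k : ℕ} (hn : 1 ≤ n) {t : ℝ}
    (ht : t ∈ Ioc (gridPt T n k) (gridPt T n (k + 1))) : stepIdx T n t = k := by
  have hμ : 0 < T / n := by positivity
  have : ⌈t / (T / n)⌉₊ = k + 1 := by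
    rw [Nat.ceil_eq_iff (by omega)]
    refine ⟨?_, ?_⟩
    · rw [lt_div_iff₀ hμ]
      exact ht.1
    · rw [div_le_iff₀ hμ]
      exact ht.2
  rw [stepIdx, this, Nat.add_sub_cancel]

theorem stepIdx_spec {T : ℝ} (hT : 0 < T) {n : ℕ} (hn : 1 ≤ n) {t : ℝ} (ht : t ∈ Ioc 0 T) :
    stepIdx T n t < n ∧
      t ∈ Ioc (gridPt T n (stepIdx T n t)) (gridPt T n (stepIdx T n t + 1)) := by
  have hμ : 0 < T / n := by positivity
  have hpos : 0 < ⌈t / (T / n)⌉₊ := Nat.ceil_pos.2 (div_pos ht.1 hμ)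
  have hle : ⌈t / (T / n)⌉₊ ≤ n := by
    rw [Nat.ceil_le, div_le_iff₀ hμ]
    have := gridPt_self T hn
    rw [gridPt] at this
    rw [this]
    exact ht.2
  have hsucc : stepIdx T n t + 1 = ⌈t / (T / n)⌉₊ := by
    rw [stepIdx]
    omega
  refine ⟨by omega, ?_, ?_⟩
  · have : stepIdx T n t < ⌈t / (T / n)⌉₊ := by omega
    rw [Nat.lt_ceil, lt_div_iff₀ hμ] at this
    exact this
  · rw [hsucc]
    have := Nat.le_ceil (t / (T / n))
    rw [div_le_iff₀ hμ] at this
    exact this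

theorem measurable_stepIdx (T : ℝ) (n : ℕ) : Measurable (stepIdx T n) :=
  (measurable_from_top (f := fun m : ℕ => m - 1)).comp
    (Nat.measurable_ceil.comp (measurable_id.div_const _))

theorem aestronglyMeasurable_comp_index {E : Type*} [TopologicalSpace E]
    [TopologicalSpace.PseudoMetrizableSpace E] {μ : Measure ℝ} {c : ℕ → ℝ → E}
    (hc : ∀ k, AEStronglyMeasurable (c k) μ) {i : ℝ → ℕ} (hi : Measurable i) :
    AEStronglyMeasurable (fun t => c (i t) t) μ := by
  have hU : (⋃ k, i ⁻¹' {k}) = univ := by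
    ext t
    simp
  rw [← Measure.restrict_univ (μ := μ), ← hU, aestronglyMeasurable_iUnion_iff]
  intro k
  refine (hc k).restrict.congr ?_
  filter_upwards [ae_restrict_mem (hi (measurableSet_singleton k))] with t ht
  rw [show i t = k from ht]

/-! ### Estimates for one run of the algorithm -/

theorem norm_le_of_mem_epsProj {E : Type*} [NormedAddCommGroup E] {S : Set E} {γ a : ℝ} {w : E}
    (hw : w ∈ epsProj S γ 0) (hγ : 0 ≤ γ) (ha : Metric.infDist 0 S ≤ a) : ‖w‖ ≤ a + √γ := by
  have h0 : 0 ≤ Metric.infDist (0 : E) S := Metric.infDist_nonneg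
  have h1 := hw.2
  rw [zero_sub, norm_neg] at h1
  have h2 := Real.sq_sqrt hγ
  have h3 := Real.sqrt_nonneg γ
  refine (pow_le_pow_iff_left₀ (norm_nonneg _) (by linarith) two_ne_zero).1 ?_
  nlinarith

theorem exists_mem_norm_sub_le_of_mem_epsEtaProj {E : Type*} [NormedAddCommGroup E]
    {C : Set E} {ε η : ℝ} {u w : E}
    (hw : w ∈ epsEtaProj C ε η u) : ∃ c ∈ C, ‖w - c‖ ≤ η := by
  obtain ⟨S', -, -, h2, h3, -⟩ := hw
  obtain ⟨c, hc, e, he, hce⟩ := h2 h3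
  refine ⟨c, hc, ?_⟩
  rw [← hce]
  simpa using he

/-- The gap `y_k + ∫ f(s, y_k) ds - y_{k+1}` between the point that is projected and its approximate
projection. -/
noncomputable def residual (f : ℝ → H → H) (T : ℝ) (n : ℕ) (y : ℕ → H) (k : ℕ) : H :=
  y k + (∫ s in (gridPt T n k)..(gridPt T n (k + 1)), f s (y k)) - y (k + 1)

/-- The perturbation `f(t, y_k)` along the run, for `t` in the step `]t_k, t_{k+1}]`. -/
noncomputable def pertStep (f : ℝ → H → H) (T : ℝ) (n : ℕ) (y : ℕ → H) (t : ℝ) : H :=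
  f t (y (stepIdx T n t))

/-- The approximate normal vector along the run: on the step `]t_k, t_{k+1}]` the residual divided
by the length of the step. -/
noncomputable def normalStep (f : ℝ → H → H) (T : ℝ) (n : ℕ) (y : ℕ → H) (t : ℝ) : H :=
  (T / n)⁻¹ • residual f T n y (stepIdx T n t)

namespace IsInexactCatchingUp

variable {C : Set H} {f : ℝ → H → H} {T : ℝ} {x₀ : H} {ε η : ℝ} {n : ℕ} {y : ℕ → H} {x : ℝ → H}

theorem exists_mem_near (hx : IsInexactCatchingUp C f T x₀ ε η n y x) (hx₀ : x₀ ∈ C) (hη : 0 ≤ η)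
    {k : ℕ} (hk : k ≤ n) : ∃ c ∈ C, ‖y k - c‖ ≤ η := by
  rcases k with _ | k
  · exact ⟨x₀, hx₀, by simpa [hx.node_zero] using hη⟩
  · exact exists_mem_norm_sub_le_of_mem_epsEtaProj (hx.node_succ k hk)

theorem norm_integral_le {b : H → ℝ}
    (hf : ∀ z, ∀ᵐ t ∂(volume.restrict (Icc 0 T)), ‖f t z‖ ≤ b z) (z : H) {s t : ℝ} (hs : 0 ≤ s)
    (hst : s ≤ t) (ht : t ≤ T) : ‖∫ r in s..t, f r z‖ ≤ b z * (t - s) := by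
  have := intervalIntegral.norm_integral_le_of_norm_le_const_ae (a := s) (b := t) (C := b z)
    (f := fun r => f r z) (by
      filter_upwards [(ae_restrict_iff' measurableSet_Icc).1 (hf z)] with r hr hr'
      rw [uIoc_of_le hst] at hr'
      exact hr ⟨hs.trans hr'.1.le, hr'.2.trans ht⟩)
  rwa [abs_of_nonneg (sub_nonneg.2 hst)] at this

theorem norm_residual_le (hx : IsInexactCatchingUp C f T x₀ ε η n y x) (hT : 0 < T) (hn : 1 ≤ n)
    (hx₀ : x₀ ∈ C) (hη : 0 ≤ η) (hε : 0 ≤ ε) {b : H → ℝ}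
    (hf : ∀ z, ∀ᵐ t ∂(volume.restrict (Icc 0 T)), ‖f t z‖ ≤ b z) {k : ℕ} (hk : k < n) :
    ‖residual f T n y k‖ ≤ T / n * b (y k) + (η + √ε) := by
  obtain ⟨c, hc, hyc⟩ := hx.exists_mem_near hx₀ hη hk.le
  obtain ⟨S', -, -, -, -, h4⟩ := hx.node_succ k hk
  have hI := norm_integral_le hf (y k) (gridPt_nonneg hT.le n k)
    (gridPt_mono hT.le n k.le_succ) (gridPt_le hT.le hn hk)
  rw [Nat.succ_eq_add_one, gridPt_succ T n k, add_sub_cancel_left, ← gridPt_succ T n k] at hI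
  set I := ∫ s in (gridPt T n k)..(gridPt T n (k + 1)), f s (y k)
  have hd : Metric.infDist (y k + I) C ≤ T / n * b (y k) + η := by
    refine (Metric.infDist_le_dist_of_mem hc).trans ?_
    rw [dist_eq_norm, show y k + I - c = I + (y k - c) by abel]
    refine (norm_add_le _ _).trans ?_
    linarith
  have hd0 : 0 ≤ Metric.infDist (y k + I) C := Metric.infDist_nonneg
  have h5 := Real.sq_sqrt hε
  have h6 := Real.sqrt_nonneg ε
  rw [residual]
  refine (pow_le_pow_iff_left₀ (norm_nonneg _) (by linarith) two_ne_zero).1 ?_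
  nlinarith

theorem norm_node_succ_sub_le (hx : IsInexactCatchingUp C f T x₀ ε η n y x) (hT : 0 < T)
    (hn : 1 ≤ n) (hx₀ : x₀ ∈ C) (hη : 0 ≤ η) (hε : 0 ≤ ε) {b : H → ℝ}
    (hf : ∀ z, ∀ᵐ t ∂(volume.restrict (Icc 0 T)), ‖f t z‖ ≤ b z) {k : ℕ} (hk : k < n) :
    ‖y (k + 1) - y k‖ ≤ T / n * (2 * b (y k) + (η + √ε) / (T / n)) := by
  have hμ : 0 < T / n := by positivity
  have h1 := hx.norm_residual_le hT hn hx₀ hη hε hf hk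
  have hI := norm_integral_le hf (y k) (gridPt_nonneg hT.le n k)
    (gridPt_mono hT.le n k.le_succ) (gridPt_le hT.le hn hk)
  rw [Nat.succ_eq_add_one, gridPt_succ T n k, add_sub_cancel_left, ← gridPt_succ T n k] at hI
  rw [residual] at h1
  set I := ∫ s in (gridPt T n k)..(gridPt T n (k + 1)), f s (y k)
  have h2 : y (k + 1) - y k = I - (y k + I - y (k + 1)) := by abel
  rw [h2, mul_add, mul_div_cancel₀ _ hμ.ne']
  refine (norm_sub_le _ _).trans ?_
  linarith

/-- A discrete Grönwall estimate: the nodes stay in a ball that does not depend on the number of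
steps. -/
theorem norm_node_sub_le (hx : IsInexactCatchingUp C f T x₀ ε η n y x) (hT : 0 < T)
    (hn : 1 ≤ n) (hx₀ : x₀ ∈ C) (hη : 0 ≤ η) (hε : 0 ≤ ε) {b : H → ℝ} (hb : ∀ z, 0 ≤ b z)
    {L : ℝ≥0} (hbL : LipschitzWith L b)
    (hf : ∀ z, ∀ᵐ t ∂(volume.restrict (Icc 0 T)), ‖f t z‖ ≤ b z) {D : ℝ}
    (hD : (η + √ε) / (T / n) ≤ D) {k : ℕ} (hk : k ≤ n) :
    ‖y k - x₀‖ ≤ T * (2 * b x₀ + D) * Real.exp (2 * L * T) := by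
  have hμ : 0 < T / n := by positivity
  have hD0 : 0 ≤ D := le_trans (by positivity) hD
  have hB : 0 ≤ 2 * b x₀ + D := by
    have := hb x₀
    positivity
  have hL : (0 : ℝ) ≤ L := L.2
  have key : ∀ k ≤ n, ‖y k - x₀‖ ≤
      gridPt T n k * (2 * b x₀ + D) * Real.exp (2 * L * gridPt T n k) := by
    intro k
    induction k with
    | zero => simp [hx.node_zero, gridPt_zero]
    | succ k ih =>
      intro hk
      have hg := gridPt_nonneg hT.le n k
      have h1 := ih (by omega)
      have h2 := hx.norm_node_succ_sub_le hT hn hx₀ hη hε hf hk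
      have h3 : b (y k) ≤ b x₀ + L * ‖y k - x₀‖ := by
        have := hbL.dist_le_mul (y k) x₀
        rw [Real.dist_eq, dist_eq_norm] at this
        linarith [le_abs_self (b (y k) - b x₀)]
      have h4 : ‖y (k + 1) - x₀‖ ≤ ‖y (k + 1) - y k‖ + ‖y k - x₀‖ := by
        rw [show y (k + 1) - x₀ = (y (k + 1) - y k) + (y k - x₀) by abel]
        exact norm_add_le _ _
      have h5 : ‖y (k + 1) - x₀‖ ≤
          (1 + 2 * L * (T / n)) * ‖y k - x₀‖ + T / n * (2 * b x₀ + D) := by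
        have : T / n * (2 * b (y k) + (η + √ε) / (T / n)) ≤
            T / n * (2 * (b x₀ + L * ‖y k - x₀‖) + D) := by gcongr
        linarith
      rw [gridPt_succ, mul_add (2 * (L : ℝ)), Real.exp_add]
      set a := gridPt T n k
      set m := T / n
      have h6 : 1 + 2 * L * m ≤ Real.exp (2 * L * m) := by
        linarith [Real.add_one_le_exp (2 * L * m)]
      have h7 : 1 ≤ Real.exp (2 * L * a) * Real.exp (2 * L * m) := by
        rw [← Real.exp_add]
        exact Real.one_le_exp (by positivity)
      calc ‖y (k + 1) - x₀‖
          ≤ (1 + 2 * L * m) * ‖y k - x₀‖ + m * (2 * b x₀ + D) := h5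
        _ ≤ Real.exp (2 * L * m) * (a * (2 * b x₀ + D) * Real.exp (2 * L * a))
            + m * (2 * b x₀ + D) * (Real.exp (2 * L * a) * Real.exp (2 * L * m)) := by
          refine add_le_add (mul_le_mul h6 h1 (norm_nonneg _) (Real.exp_nonneg _)) ?_
          exact le_mul_of_one_le_right (by positivity) h7
        _ = _ := by ring
  refine (key k hk).trans ?_
  have := gridPt_le hT.le hn hk
  gcongr

theorem norm_normalStep_le (hx : IsInexactCatchingUp C f T x₀ ε η n y x) (hT : 0 < T) (hn : 1 ≤ n)
    (hx₀ : x₀ ∈ C) (hη : 0 ≤ η) (hε : 0 ≤ ε) {b : H → ℝ}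
    (hf : ∀ z, ∀ᵐ t ∂(volume.restrict (Icc 0 T)), ‖f t z‖ ≤ b z) {t : ℝ} (ht : t ∈ Ioc 0 T) :
    ‖normalStep f T n y t‖ ≤ b (y (stepIdx T n t)) + (η + √ε) / (T / n) := by
  have hμ : 0 < T / n := by positivity
  have h1 := hx.norm_residual_le hT hn hx₀ hη hε hf (stepIdx_spec hT hn ht).1
  rw [normalStep, norm_smul, norm_inv, Real.norm_of_nonneg hμ.le, inv_mul_le_iff₀ hμ, mul_add,
    mul_div_cancel₀ _ hμ.ne']
  exact h1

end IsInexactCatchingUp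

theorem ae_norm_pertStep_le {E : Type*} [NormedAddCommGroup E] {f : ℝ → E → E} {T : ℝ}
    {b : E → ℝ}
    (hf : ∀ z, ∀ᵐ t ∂(volume.restrict (Icc 0 T)), ‖f t z‖ ≤ b z) (n : ℕ) (y : ℕ → E) :
    ∀ᵐ t ∂(volume.restrict (Icc 0 T)), ‖pertStep f T n y t‖ ≤ b (y (stepIdx T n t)) := by
  filter_upwards [ae_all_iff.2 fun k => hf (y k)] with t ht
  exact ht _

theorem aestronglyMeasurable_pertStep {E : Type*} [NormedAddCommGroup E] {f : ℝ → E → E} {T : ℝ}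
    (hf : ∀ z, AEStronglyMeasurable (fun t => f t z) (volume.restrict (Icc 0 T)))
    (n : ℕ) (y : ℕ → E) :
    AEStronglyMeasurable (pertStep f T n y) (volume.restrict (Icc 0 T)) :=
  aestronglyMeasurable_comp_index (c := fun k t => f t (y k)) (fun k => hf (y k))
    (measurable_stepIdx T n)

theorem aestronglyMeasurable_normalStep (f : ℝ → H → H) (T : ℝ) (n : ℕ) (y : ℕ → H)
    (μ : Measure ℝ) : AEStronglyMeasurable (normalStep f T n y) μ :=
  aestronglyMeasurable_comp_index (c := fun k _ => (T / n)⁻¹ • residual f T n y k)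
    (fun _ => aestronglyMeasurable_const) (measurable_stepIdx T n)

namespace IsInexactCatchingUp

variable {C : Set H} {f : ℝ → H → H} {T : ℝ} {x₀ : H} {ε η : ℝ} {n : ℕ} {y : ℕ → H} {x : ℝ → H}

/-- The interpolation is the primitive of the perturbation minus the approximate normal vector. -/
theorem traj_eq_integral [CompleteSpace H] (hx : IsInexactCatchingUp C f T x₀ ε η n y x)
    (hT : 0 < T) (hn : 1 ≤ n)
    (hf : ∀ z, IntegrableOn (fun t => f t z) (Icc 0 T))
    (hp : IntegrableOn (fun t => pertStep f T n y t - normalStep f T n y t) (Icc 0 T))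
    {t : ℝ} (ht : t ∈ Icc 0 T) :
    x t = x₀ + ∫ s in (0)..t, (pertStep f T n y s - normalStep f T n y s) := by
  have hμ : 0 < T / n := by positivity
  have hII : ∀ {g : ℝ → H}, IntegrableOn g (Icc 0 T) → ∀ {r s : ℝ}, 0 ≤ r → r ≤ s → s ≤ T →
      IntervalIntegrable g volume r s := by
    intro g hg r s hr hrs hs
    rw [intervalIntegrable_iff_integrableOn_Icc_of_le hrs]
    exact hg.mono_set (Icc_subset_Icc hr hs)
  have hstep : ∀ k < n, ∀ t ∈ Icc (gridPt T n k) (gridPt T n (k + 1)),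
      ∫ s in (gridPt T n k)..t, (pertStep f T n y s - normalStep f T n y s) =
        ((t - gridPt T n k) / (T / n)) • (-residual f T n y k)
          + ∫ s in (gridPt T n k)..t, f s (y k) := by
    intro k hk t ht
    have hc : ∫ s in (gridPt T n k)..t, (pertStep f T n y s - normalStep f T n y s) =
        ∫ s in (gridPt T n k)..t, (f s (y k) - (T / n)⁻¹ • residual f T n y k) := by
      refine intervalIntegral.integral_congr_ae (Eventually.of_forall fun s hs => ?_)
      rw [uIoc_of_le ht.1] at hs
      have : stepIdx T n s = k := stepIdx_eq hT hn ⟨hs.1, hs.2.trans ht.2⟩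
      simp only [pertStep, normalStep, this]
    rw [hc, intervalIntegral.integral_sub
      (hII (hf (y k)) (gridPt_nonneg hT.le n k) ht.1 (ht.2.trans (gridPt_le hT.le hn hk)))
      intervalIntegrable_const, intervalIntegral.integral_const, smul_smul, smul_neg,
      div_eq_mul_inv]
    abel
  have hnode : ∀ k ≤ n, y k =
      x₀ + ∫ s in (0)..(gridPt T n k), (pertStep f T n y s - normalStep f T n y s) := by
    intro k
    induction k with
    | zero => simp [hx.node_zero, gridPt_zero]
    | succ k ih =>
      intro hk
      have hle := gridPt_mono hT.le n k.le_succ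
      have h0 := gridPt_nonneg hT.le n k
      have h1 := gridPt_le hT.le hn hk
      rw [← intervalIntegral.integral_add_adjacent_intervals (b := gridPt T n k)
        (hII hp le_rfl h0 (hle.trans h1)) (hII hp h0 hle h1), ← add_assoc, ← ih (by omega),
        hstep k hk _ ⟨hle, le_rfl⟩, gridPt_succ T n k, add_sub_cancel_left, div_self hμ.ne',
        one_smul, ← gridPt_succ T n k, residual]
      abel
  rcases ht.1.eq_or_lt with h0 | h0
  · rw [← h0, hx.traj_zero]
    simp
  · obtain ⟨hk, hkt⟩ := stepIdx_spec hT hn (t := t) ⟨h0, ht.2⟩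
    set k := stepIdx T n t
    have hg := gridPt_nonneg hT.le n k
    rw [← intervalIntegral.integral_add_adjacent_intervals (b := gridPt T n k)
        (hII hp le_rfl hg (hkt.1.le.trans ht.2)) (hII hp hg hkt.1.le ht.2), ← add_assoc,
        ← hnode k hk.le, hstep k hk t ⟨hkt.1.le, hkt.2⟩, hx.traj k hk t hkt, residual, add_assoc]
    congr 3
    abel

theorem traj_gridPt (hx : IsInexactCatchingUp C f T x₀ ε η n y x) (hT : 0 < T) {k : ℕ}
    (hk : k ≤ n) : x (gridPt T n k) = y k := by
  rcases k with _ | k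
  · rw [gridPt_zero, hx.traj_zero, hx.node_zero]
  · have hμ : 0 < T / n := by
      have : 0 < (n : ℝ) := by exact_mod_cast (by omega : 0 < n)
      positivity
    have hg := gridPt_succ T n k
    rw [hx.traj k hk _ ⟨by linarith, le_rfl⟩]
    have : (gridPt T n (k + 1) - gridPt T n k) / (T / n) = 1 := by
      rw [hg, add_sub_cancel_left, div_self hμ.ne']
    rw [this, one_smul]
    abel

theorem lipschitzOnWith [CompleteSpace H] (hx : IsInexactCatchingUp C f T x₀ ε η n y x)
    (hT : 0 < T) (hn : 1 ≤ n)
    (hf : ∀ z, IntegrableOn (fun t => f t z) (Icc 0 T))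
    (hp : IntegrableOn (fun t => pertStep f T n y t - normalStep f T n y t) (Icc 0 T)) {K : ℝ≥0}
    (hK : ∀ᵐ t ∂(volume.restrict (Icc 0 T)), ‖pertStep f T n y t - normalStep f T n y t‖ ≤ K) :
    LipschitzOnWith K x (Icc 0 T) := by
  have hint : ∀ t ∈ Icc 0 T, IntervalIntegrable
      (fun t => pertStep f T n y t - normalStep f T n y t) volume 0 t := by
    intro t ht
    rw [intervalIntegrable_iff_integrableOn_Icc_of_le ht.1]
    exact hp.mono_set (Icc_subset_Icc le_rfl ht.2)
  refine LipschitzOnWith.of_dist_le_mul fun t ht s hs => ?_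
  rw [dist_eq_norm, hx.traj_eq_integral hT hn hf hp ht, hx.traj_eq_integral hT hn hf hp hs,
    add_sub_add_left_eq_sub, intervalIntegral.integral_interval_sub_left (hint t ht) (hint s hs)]
  refine intervalIntegral.norm_integral_le_of_norm_le_const_ae ?_
  filter_upwards [(ae_restrict_iff' measurableSet_Icc).1 hK] with r hr hr'
  have := uIoc_subset_uIcc.trans (uIcc_subset_Icc hs ht) hr'
  exact hr this

/-- Nodes next to a time `t` are close to the trajectory at `t`. -/
theorem dist_node_le (hx : IsInexactCatchingUp C f T x₀ ε η n y x) (hT : 0 < T) (hn : 1 ≤ n)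
    {K : ℝ≥0} (hK : LipschitzOnWith K x (Icc 0 T)) {t : ℝ} (ht : t ∈ Ioc 0 T) :
    dist (y (stepIdx T n t)) (x t) ≤ K * (T / n) ∧
      dist (y (stepIdx T n t + 1)) (x t) ≤ K * (T / n) := by
  obtain ⟨hk, hkt⟩ := stepIdx_spec hT hn ht
  have hg := gridPt_succ T n (stepIdx T n t)
  have key : ∀ l, l ≤ n → |gridPt T n l - t| ≤ T / n → dist (y l) (x t) ≤ K * (T / n) := by
    intro l hl hlt
    rw [← hx.traj_gridPt hT hl]
    refine (hK.dist_le_mul _ ⟨gridPt_nonneg hT.le n l, gridPt_le hT.le hn hl⟩ _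
      (Ioc_subset_Icc_self ht)).trans ?_
    gcongr
    exact hlt
  constructor
  · refine key _ hk.le (abs_le.2 ⟨?_, ?_⟩) <;> linarith [hkt.1, hkt.2]
  · refine key _ hk (abs_le.2 ⟨?_, ?_⟩) <;> linarith [hkt.1, hkt.2]

end IsInexactCatchingUp

/-! ### Passage to the limit in the normal cone and in the perturbation -/

/-- Comparison of an approximate projection with the competitor `c + τ d` of `C`, where `c ∈ C` is
within `η` of the approximate projection. -/
theorem inner_le_of_mem_epsEtaProj {C : Set H} {e η τ : ℝ} {u w c d : H}
    (hw : w ∈ epsEtaProj C e η u) (hτ : 0 ≤ τ) (hc : ‖w - c‖ ≤ η)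
    (hd : c + τ • d ∈ C) :
    2 * τ * inner ℝ (u - w) d ≤ 2 * ‖u - w‖ * η + 2 * η ^ 2 + 2 * τ ^ 2 * ‖d‖ ^ 2 + e := by
  obtain ⟨S', -, -, -, -, hlt⟩ := hw
  have h1 : Metric.infDist u C ≤ ‖u - (c + τ • d)‖ := by
    rw [← dist_eq_norm]
    exact Metric.infDist_le_dist_of_mem hd
  have h2 : Metric.infDist u C ^ 2 ≤ ‖u - (c + τ • d)‖ ^ 2 :=
    pow_le_pow_left₀ Metric.infDist_nonneg h1 2
  have h3 : u - (c + τ • d) = (u - w) + ((w - c) - τ • d) := by abel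
  rw [h3, norm_add_sq_real, inner_sub_right, real_inner_smul_right] at h2
  have h4 : inner ℝ (u - w) (w - c) ≤ ‖u - w‖ * η :=
    (real_inner_le_norm _ _).trans (mul_le_mul_of_nonneg_left hc (norm_nonneg _))
  have h5 : ‖(w - c) - τ • d‖ ≤ η + τ * ‖d‖ := by
    refine (norm_sub_le _ _).trans ?_
    rw [norm_smul, Real.norm_of_nonneg hτ]
    linarith
  have h6 : ‖(w - c) - τ • d‖ ^ 2 ≤ (η + τ * ‖d‖) ^ 2 := pow_le_pow_left₀ (norm_nonneg _) h5 2
  have h7 : (η + τ * ‖d‖) ^ 2 ≤ 2 * η ^ 2 + 2 * τ ^ 2 * ‖d‖ ^ 2 := by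
    nlinarith [sq_nonneg (η - τ * ‖d‖)]
  linarith

/-- Rescaled residuals of approximate projections are asymptotically normal: in every Clarke tangent
direction at the limit point their upper limit is nonpositive. -/
theorem eventually_inner_le_of_mem_clarkeTangentCone {C : Set H} {X d : H} {M : ℝ}
    {e η μ : ℕ → ℝ} {u w : ℕ → H} (he : ∀ n, 0 < e n) (hη : ∀ n, 0 ≤ η n) (hμ : ∀ n, 0 < μ n)
    (hμ0 : Tendsto μ atTop (𝓝 0)) (heμ : Tendsto (fun n => e n / μ n ^ 2) atTop (𝓝 0))
    (hημ : Tendsto (fun n => η n / μ n) atTop (𝓝 0))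
    (hw : ∀ n, w n ∈ epsEtaProj C (e n) (η n) (u n))
    (hwX : Tendsto w atTop (𝓝 X)) (hM : ∀ n, ‖(μ n)⁻¹ • (u n - w n)‖ ≤ M)
    (hd : d ∈ clarkeTangentCone C X) {a : ℝ} (ha : 0 < a) :
    ∀ᶠ n in atTop, inner ℝ ((μ n)⁻¹ • (u n - w n)) d ≤ a := by
  -- The competitors are taken at distance `τ = μ σ` with `σ → 0` so slowly that
  -- `η / τ` and `e / (τ μ)` still vanish; both are at most `σ`.
  set σ : ℕ → ℝ := fun n => √(η n / μ n + e n / μ n ^ 2) with hσ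
  have hpos : ∀ n, 0 < η n / μ n + e n / μ n ^ 2 := fun n =>
    add_pos_of_nonneg_of_pos (div_nonneg (hη n) (hμ n).le) (div_pos (he n) (pow_pos (hμ n) 2))
  have hσpos : ∀ n, 0 < σ n := fun n => Real.sqrt_pos.2 (hpos n)
  have hσ0 : Tendsto σ atTop (𝓝 0) := by
    have := (hημ.add heμ).sqrt
    simpa using this
  choose c hcC hcw using fun n => exists_mem_norm_sub_le_of_mem_epsEtaProj (hw n)
  have hη0 : Tendsto η atTop (𝓝 0) := by
    have := hημ.mul hμ0
    simp only [mul_zero] at this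
    exact this.congr fun n => div_mul_cancel₀ _ (hμ n).ne'
  have hcX : Tendsto c atTop (𝓝 X) := by
    have h0 : Tendsto (fun n => w n - c n) atTop (𝓝 0) := squeeze_zero_norm hcw hη0
    simpa using hwX.sub h0
  have hτ0 : Tendsto (fun n => μ n * σ n) atTop (𝓝 0) := by simpa using hμ0.mul hσ0
  obtain ⟨v, hv, hvC⟩ := hd c (fun n => μ n * σ n) hcC hcX
    (fun n => mul_pos (hμ n) (hσpos n)) hτ0
  have hbound : ∀ n, inner ℝ ((μ n)⁻¹ • (u n - w n)) d ≤
      σ n * (M + η n / μ n + ‖v n‖ ^ 2 + 1) + M * ‖d - v n‖ := by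
    intro n
    have hm := hμ n
    have hs := hσpos n
    have h1 := inner_le_of_mem_epsEtaProj (hw n) (mul_pos hm hs).le (hcw n) (hvC n)
    set z := (μ n)⁻¹ • (u n - w n) with hz
    have hzr : u n - w n = μ n • z := by rw [hz, smul_inv_smul₀ hm.ne']
    obtain ⟨p, hp⟩ : ∃ p, p = η n / μ n := ⟨_, rfl⟩
    obtain ⟨q, hq⟩ : ∃ q, q = e n / μ n ^ 2 := ⟨_, rfl⟩
    have hp' : η n = μ n * p := by rw [hp, mul_div_cancel₀ _ hm.ne']
    have hq' : e n = μ n ^ 2 * q := by rw [hq, mul_div_cancel₀ _ (pow_pos hm 2).ne']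
    have hp0 : 0 ≤ p := hp ▸ div_nonneg (hη n) hm.le
    have hq0 : 0 ≤ q := hq ▸ (div_pos (he n) (pow_pos hm 2)).le
    have hs2 : σ n ^ 2 = p + q := by
      rw [hp, hq]
      exact Real.sq_sqrt (hpos n).le
    rw [hzr, real_inner_smul_left, norm_smul, Real.norm_of_nonneg hm.le, hp', hq'] at h1
    have h2 : 2 * σ n * inner ℝ z (v n) ≤
        2 * ‖z‖ * p + 2 * p ^ 2 + 2 * σ n ^ 2 * ‖v n‖ ^ 2 + q := by
      refine le_of_mul_le_mul_left ?_ (pow_pos hm 2)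
      linarith
    have h3 : ‖z‖ * p ≤ M * σ n ^ 2 := by
      have h0 : 0 ≤ ‖z‖ := norm_nonneg z
      have := hM n
      rw [hs2]
      exact mul_le_mul this (by linarith) hp0 (h0.trans this)
    have h4 : inner ℝ z (v n) ≤ σ n * (M + p + ‖v n‖ ^ 2 + 1) := by
      refine le_of_mul_le_mul_left ?_ (mul_pos two_pos hs)
      refine h2.trans ?_
      have h5 : p ^ 2 ≤ σ n ^ 2 * p := by
        rw [hs2]
        nlinarith
      nlinarith
    have h6 : inner ℝ z (d - v n) ≤ M * ‖d - v n‖ :=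
      (real_inner_le_norm _ _).trans (mul_le_mul_of_nonneg_right (hM n) (norm_nonneg _))
    rw [inner_sub_right] at h6
    rw [← hp]
    linarith
  have hlim : Tendsto (fun n => σ n * (M + η n / μ n + ‖v n‖ ^ 2 + 1) + M * ‖d - v n‖) atTop
      (𝓝 0) := by
    have h1 := hσ0.mul (((hημ.const_add M).add (hv.norm.pow 2)).add_const 1)
    have h2 := ((tendsto_const_nhds (x := d)).sub hv).norm.const_mul M
    simpa using h1.add h2
  filter_upwards [hlim.eventually (gt_mem_nhds ha)] with n hn
  exact (hbound n).trans hn.le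

/-- Every element of the tail hull of rescaled residuals of approximate projections that converge to
`X` is a Clarke normal vector at `X`. -/
theorem mem_clarkeNormalCone_of_mem_tailHull {C : Set H} {X z : H} (hX : X ∈ C) {M : ℝ}
    {e η μ : ℕ → ℝ} {u w : ℕ → H} (he : ∀ n, 0 < e n) (hη : ∀ n, 0 ≤ η n) (hμ : ∀ n, 0 < μ n)
    (hμ0 : Tendsto μ atTop (𝓝 0)) (heμ : Tendsto (fun n => e n / μ n ^ 2) atTop (𝓝 0))
    (hημ : Tendsto (fun n => η n / μ n) atTop (𝓝 0))
    (hw : ∀ n, w n ∈ epsEtaProj C (e n) (η n) (u n))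
    (hwX : Tendsto w atTop (𝓝 X)) (hM : ∀ n, ‖(μ n)⁻¹ • (u n - w n)‖ ≤ M)
    (hz : z ∈ tailHull fun n => (μ n)⁻¹ • (u n - w n)) : z ∈ clarkeNormalCone C X := by
  refine ⟨hX, fun d hd => le_of_forall_pos_le_add fun a ha => ?_⟩
  have hmem : z ∈ innerSL ℝ d ⁻¹' Iic a := by
    refine mem_of_mem_tailHull hz ?_ (isClosed_Iic.preimage (innerSL ℝ d).continuous) ?_
    · exact (convex_Iic a).linear_preimage (innerSL ℝ d : H →ₗ[ℝ] ℝ)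
    · filter_upwards [eventually_inner_le_of_mem_clarkeTangentCone he hη hμ hμ0 heμ hημ hw hwX hM
        hd ha] with n hn
      rw [mem_preimage, innerSL_apply_apply, real_inner_comm]
      exact hn
  rw [mem_preimage, innerSL_apply_apply, real_inner_comm] at hmem
  simpa using hmem

/-- Weak upper semicontinuity with closed convex values is preserved under passage to the tail hull
of selections. -/
theorem mem_of_mem_tailHull_of_isWeaklyUSC {G : H → Set H} (hG : IsWeaklyUSC G)
    {X ξ : H} (hGc : IsClosed (G X)) (hGconv : Convex ℝ (G X)) {y w : ℕ → H}
    (hy : Tendsto y atTop (𝓝 X)) (hw : ∀ n, w n ∈ G (y n)) (hξ : ξ ∈ tailHull w) : ξ ∈ G X := by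
  by_contra hn
  obtain ⟨l, a, hl, ha⟩ := geometric_hahn_banach_closed_point hGconv hGc hn
  set D : Set (WeakSpace ℝ H) := {z | a ≤ l ((toWeakSpace ℝ H).symm z)} with hD
  have hDc : IsClosed D := by
    refine isClosed_le continuous_const ?_
    exact WeakBilin.eval_continuous (topDualPairing ℝ H).flip l
  have hcl := hG D hDc
  have hX : X ∉ {x : H | (G x ∩ toWeakSpace ℝ H ⁻¹' D).Nonempty} := by
    rintro ⟨z, hz, hzD⟩
    exact absurd (hl z hz) (not_lt.2 hzD)
  have hev : ∀ᶠ n in atTop, l (w n) ≤ a := by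
    filter_upwards [hy.eventually (hcl.isOpen_compl.mem_nhds hX)] with n hn
    by_contra hlt
    exact hn ⟨w n, hw n, (not_le.1 hlt).le⟩
  have : ξ ∈ l ⁻¹' Iic a := by
    refine mem_of_mem_tailHull hξ ?_ (isClosed_Iic.preimage l.continuous) hev
    exact (convex_Iic a).linear_preimage (l : H →ₗ[ℝ] ℝ)
  exact absurd ha (not_lt.2 this)

end Runs

/-! ### Derivatives of limits of primitives -/

/-- If the primitives of `D ∘ g j`, with `g j` uniformly bounded, converge pointwise to `X`, then
almost everywhere `X` is differentiable with derivative `D p`, where `p` belongs to the tail hull of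
the values `g j t`. No strong or weak compactness of `g j` is needed beyond `tailHull_nonempty` in
`L²`: an element of the tail hull there has the right primitive, since the integrals of `D ∘ g j`
over `[0, t]`, tested with a vector, are continuous linear functionals of `g j`. -/
theorem ae_exists_mem_tailHull_hasDerivAt {E G : Type*} [NormedAddCommGroup E]
    [InnerProductSpace ℝ E] [CompleteSpace E] [NormedAddCommGroup G] [InnerProductSpace ℝ G]
    [CompleteSpace G] (D : E →L[ℝ] G) {T : ℝ} (hT : 0 ≤ T) {g : ℕ → ℝ → E} {M : ℝ} {x₀ : G}
    {X : ℝ → G}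
    (hg : ∀ j, AEStronglyMeasurable (g j) (volume.restrict (Icc 0 T)))
    (hM : ∀ j, ∀ᵐ t ∂(volume.restrict (Icc 0 T)), ‖g j t‖ ≤ M)
    (hX : ∀ t ∈ Icc 0 T, Tendsto (fun j => x₀ + ∫ s in (0)..t, D (g j s)) atTop (𝓝 (X t))) :
    ∀ᵐ t ∂(volume.restrict (Icc 0 T)), ∃ p ∈ tailHull fun j => g j t, HasDerivAt X (D p) t := by
  set ν : Measure ℝ := volume.restrict (Icc 0 T) with hν
  have hmem : ∀ j, MemLp (g j) 2 ν := fun j => MemLp.of_bound (hg j) M (hM j)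
  have hbd : ∀ j, ‖(hmem j).toLp (g j)‖ ≤
      (measureUnivNNReal ν : ℝ) ^ ((2 : ENNReal).toReal⁻¹) * |M| := by
    intro j
    refine Lp.norm_le_of_ae_bound (abs_nonneg M) ?_
    filter_upwards [(hmem j).coeFn_toLp, hM j] with t h1 h2
    rw [h1]
    exact h2.trans (le_abs_self M)
  obtain ⟨p, hp⟩ := tailHull_nonempty (fun j => (hmem j).toLp (g j)) _ hbd
  have hpt : ∀ᵐ t ∂ν, p t ∈ tailHull fun j => g j t :=
    ae_mem_tailHull hp fun j => (hmem j).coeFn_toLp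
  have hpint : Integrable p ν := (Lp.memLp p).integrable one_le_two
  have hDp : IntegrableOn (fun s => D (p s)) (Icc 0 T) := D.integrable_comp hpint
  have hprim : ∀ t ∈ Icc 0 T, X t = x₀ + ∫ s in (0)..t, D (p s) := by
    intro t ht
    have hsub : Ioc 0 t ⊆ Icc 0 T := fun s hs => ⟨hs.1.le, hs.2.trans ht.2⟩
    have hrr : ν.restrict (Ioc 0 t) = volume.restrict (Ioc 0 t) :=
      Measure.restrict_restrict_of_subset hsub
    have hfun : ∀ (c : G) (q : Lp E 2 ν),
        inner ℝ (indicatorConstLp 2 (measurableSet_Ioc (a := 0) (b := t))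
          (measure_ne_top ν _) (ContinuousLinearMap.adjoint D c)) q =
        inner ℝ c (∫ s in (0)..t, D (q s)) := by
      intro c q
      rw [L2.inner_indicatorConstLp_eq_inner_setIntegral, ContinuousLinearMap.adjoint_inner_left,
        hrr, intervalIntegral.integral_of_le ht.1, ContinuousLinearMap.integral_comp_comm]
      rw [← hrr]
      exact ((Lp.memLp q).integrable one_le_two).restrict
    have hcongr : ∀ j, ∫ s in (0)..t, D ((hmem j).toLp (g j) s) = ∫ s in (0)..t, D (g j s) := by
      intro j
      rw [intervalIntegral.integral_of_le ht.1, intervalIntegral.integral_of_le ht.1, ← hrr]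
      refine integral_congr_ae (ae_restrict_of_ae ?_)
      filter_upwards [(hmem j).coeFn_toLp] with s hs
      rw [hs]
    rw [← sub_eq_iff_eq_add']
    refine ext_inner_left ℝ fun c => ?_
    rw [← hfun c p]
    refine (apply_eq_of_mem_tailHull hp (innerSL ℝ _) ?_).symm
    have h1 : Tendsto (fun j => inner ℝ c ((x₀ + ∫ s in (0)..t, D (g j s)) - x₀)) atTop
        (𝓝 (inner ℝ c (X t - x₀))) :=
      tendsto_const_nhds.inner ((hX t ht).sub_const x₀)
    refine h1.congr fun j => ?_
    rw [innerSL_apply_apply, hfun, hcongr, add_sub_cancel_left]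
  have hint : IntervalIntegrable (fun s => D (p s)) volume 0 T :=
    (intervalIntegrable_iff_integrableOn_Icc_of_le hT).2 hDp
  have hIoo : ∀ᵐ t ∂ν, t ∈ Ioo 0 T := by
    rw [hν, ← Measure.restrict_congr_set Ioo_ae_eq_Icc]
    exact ae_restrict_mem measurableSet_Ioo
  filter_upwards [hpt, hIoo, ae_restrict_of_ae hint.ae_hasDerivAt_integral] with t h1 h2 h3
  refine ⟨p t, h1, ?_⟩
  have h4 := (h3 (by rw [uIcc_of_le hT]; exact Ioo_subset_Icc_self h2) 0
    (by rw [uIcc_of_le hT]; exact ⟨le_rfl, hT⟩)).const_add x₀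
  refine h4.congr_of_eventuallyEq ?_
  filter_upwards [Ioo_mem_nhds h2.1 h2.2] with s hs
  exact hprim s (Ioo_subset_Icc_self hs)

theorem norm_toLp_prod_le {E F : Type*} [SeminormedAddCommGroup E] [SeminormedAddCommGroup F]
    (u : E) (v : F) : ‖WithLp.toLp 2 (u, v)‖ ≤ ‖u‖ + ‖v‖ := by
  rw [WithLp.prod_norm_eq_of_L2]
  refine Real.sqrt_le_iff.2 ⟨by positivity, ?_⟩
  change ‖u‖ ^ 2 + ‖v‖ ^ 2 ≤ _
  nlinarith [norm_nonneg u, norm_nonneg v]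

/-! ### Bounds independent of the number of steps -/

/-- The runs with at least one step are uniformly Lipschitz, their perturbations and approximate
normal vectors are uniformly bounded, and they approach a compact subset of `C` uniformly. -/
theorem exists_uniform_bounds {H : Type*} [NormedAddCommGroup H] [InnerProductSpace ℝ H]
    [CompleteSpace H] {T : ℝ} (hT : 0 < T) {C : Set H} (hC : IsBallCompact C) {x₀ : H}
    (hx₀ : x₀ ∈ C) {b : H → ℝ} (hb : ∀ z, 0 ≤ b z) {L : ℝ≥0} (hbL : LipschitzWith L b)
    {f : ℝ → H → H} (hfb : ∀ z, ∀ᵐ t ∂(volume.restrict (Icc 0 T)), ‖f t z‖ ≤ b z)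
    (hf_meas : ∀ z, AEStronglyMeasurable (fun t => f t z) (volume.restrict (Icc 0 T)))
    {ε η : ℕ → ℝ} (hε : ∀ n, 1 ≤ n → 0 < ε n) (hη : ∀ n, 1 ≤ n → 0 < η n)
    (hηlim : Tendsto η atTop (𝓝 0))
    (hδlim : Tendsto (fun n : ℕ => (η n + √(ε n)) / (T / n)) atTop (𝓝 0))
    {y : ℕ → ℕ → H} {x : ℕ → ℝ → H}
    (hx : ∀ n, 1 ≤ n → IsInexactCatchingUp C f T x₀ (ε n) (η n) n (y n) (x n)) :
    ∃ (M : ℝ) (K : ℝ≥0) (A : Set H), IsCompact A ∧ A ⊆ C ∧ ∀ n, 1 ≤ n →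
      (∀ᵐ t ∂(volume.restrict (Icc 0 T)), ‖pertStep f T n (y n) t‖ ≤ M) ∧
      (∀ t ∈ Ioc 0 T, ‖normalStep f T n (y n) t‖ ≤ M) ∧
      LipschitzOnWith K (x n) (Icc 0 T) ∧
      (∀ t ∈ Icc 0 T, ∃ a ∈ A, dist (x n t) a ≤ K * (T / n) + η n) ∧
      ∀ t ∈ Icc 0 T,
        x n t = x₀ + ∫ s in (0)..t, (pertStep f T n (y n) s - normalStep f T n (y n) s) := by
  set ν : Measure ℝ := volume.restrict (Icc 0 T) with hν
  have hfint : ∀ z, IntegrableOn (fun t => f t z) (Icc 0 T) := fun z =>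
    Integrable.of_bound (hf_meas z) (b z) (hfb z)
  have hIoo : ∀ᵐ t ∂ν, t ∈ Ioo 0 T := by
    rw [hν, ← Measure.restrict_congr_set Ioo_ae_eq_Icc]
    exact ae_restrict_mem measurableSet_Ioo
  set δ : ℕ → ℝ := fun n => (η n + √(ε n)) / (T / n) with hδdef
  obtain ⟨D, hD⟩ := hδlim.bddAbove_range
  replace hD : ∀ n, δ n ≤ D := fun n => hD (mem_range_self n)
  have hD0 : 0 ≤ D := by
    refine le_trans ?_ (hD 1)
    have := (hη 1 le_rfl).le
    positivity
  obtain ⟨B, hB⟩ := hηlim.bddAbove_range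
  replace hB : ∀ n, η n ≤ B := fun n => hB (mem_range_self n)
  set R : ℝ := T * (2 * b x₀ + D) * Real.exp (2 * L * T) with hR
  have hyR : ∀ n, 1 ≤ n → ∀ k ≤ n, ‖y n k - x₀‖ ≤ R := fun n hn k hk =>
    (hx n hn).norm_node_sub_le hT hn hx₀ (hη n hn).le (hε n hn).le hb hbL hfb (hD n) hk
  set M : ℝ := b x₀ + L * R with hMdef
  have hbM : ∀ n, 1 ≤ n → ∀ k ≤ n, b (y n k) ≤ M := by
    intro n hn k hk
    have h1 := hbL.dist_le_mul (y n k) x₀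
    rw [Real.dist_eq, dist_eq_norm] at h1
    have h2 := mul_le_mul_of_nonneg_left (hyR n hn k hk) L.2
    have h3 := le_abs_self (b (y n k) - b x₀)
    change (L : ℝ) * _ ≤ L * R at h2
    linarith
  have hZle : ∀ n, 1 ≤ n → ∀ t ∈ Ioc 0 T,
      ‖normalStep f T n (y n) t‖ ≤ b (y n (stepIdx T n t)) + δ n := fun n hn t ht =>
    (hx n hn).norm_normalStep_le hT hn hx₀ (hη n hn).le (hε n hn).le hfb ht
  have hZM : ∀ n, 1 ≤ n → ∀ t ∈ Ioc 0 T, ‖normalStep f T n (y n) t‖ ≤ M + D := by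
    intro n hn t ht
    exact (hZle n hn t ht).trans (add_le_add (hbM n hn _ (stepIdx_spec hT hn ht).1.le) (hD n))
  have hPM : ∀ n, 1 ≤ n → ∀ᵐ t ∂ν, ‖pertStep f T n (y n) t‖ ≤ M := by
    intro n hn
    filter_upwards [ae_norm_pertStep_le hfb n (y n), hIoo] with t h1 h2
    exact h1.trans (hbM n hn _ (stepIdx_spec hT hn (Ioo_subset_Ioc_self h2)).1.le)
  have hPmeas := fun n => aestronglyMeasurable_pertStep hf_meas n (y n)
  have hZmeas := fun n => aestronglyMeasurable_normalStep f T n (y n) ν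
  set K : ℝ≥0 := (M + (M + D)).toNNReal with hKdef
  have hPZ : ∀ n, 1 ≤ n → ∀ᵐ t ∂ν, ‖pertStep f T n (y n) t - normalStep f T n (y n) t‖ ≤ K := by
    intro n hn
    filter_upwards [hPM n hn, hIoo] with t h1 h2
    refine le_trans ?_ (Real.le_coe_toNNReal _)
    exact (norm_sub_le _ _).trans (add_le_add h1 (hZM n hn t (Ioo_subset_Ioc_self h2)))
  have hPZint : ∀ n, 1 ≤ n →
      IntegrableOn (fun t => pertStep f T n (y n) t - normalStep f T n (y n) t) (Icc 0 T) :=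
    fun n hn => Integrable.of_bound ((hPmeas n).sub (hZmeas n)) K (hPZ n hn)
  have hxlip : ∀ n, 1 ≤ n → LipschitzOnWith K (x n) (Icc 0 T) := fun n hn =>
    (hx n hn).lipschitzOnWith hT hn hfint (hPZint n hn) (hPZ n hn)
  set A : Set H := C ∩ Metric.closedBall 0 (‖x₀‖ + |R| + |B| + 1) with hA
  have hAc : IsCompact A := hC _ (by positivity)
  have hxA : ∀ n, 1 ≤ n → ∀ t ∈ Icc 0 T, ∃ a ∈ A, dist (x n t) a ≤ K * (T / n) + η n := by
    intro n hn t ht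
    rcases ht.1.eq_or_lt with h0 | h0
    · refine ⟨x₀, ⟨hx₀, ?_⟩, ?_⟩
      · rw [mem_closedBall_zero_iff]
        linarith [abs_nonneg R, abs_nonneg B]
      · rw [← h0, (hx n hn).traj_zero, dist_self]
        have := (hη n hn).le
        positivity
    · have ht' : t ∈ Ioc 0 T := ⟨h0, ht.2⟩
      have hk := (stepIdx_spec hT hn ht').1.le
      obtain ⟨c, hc, hyc⟩ := (hx n hn).exists_mem_near hx₀ (hη n hn).le hk
      refine ⟨c, ⟨hc, ?_⟩, ?_⟩
      · rw [mem_closedBall_zero_iff]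
        have h1 := hyR n hn _ hk
        have h2 : ‖c‖ ≤ ‖x₀‖ + ‖y n (stepIdx T n t) - x₀‖ + ‖y n (stepIdx T n t) - c‖ := by
          rw [show c = x₀ + (y n (stepIdx T n t) - x₀) - (y n (stepIdx T n t) - c) by abel]
          refine (norm_sub_le _ _).trans (add_le_add (norm_add_le _ _) (le_of_eq ?_))
          congr 1
          abel
        linarith [hB n, le_abs_self R, le_abs_self B]
      · have h1 := ((hx n hn).dist_node_le hT hn (hxlip n hn) ht').1
        rw [dist_comm] at h1
        rw [← dist_eq_norm] at hyc
        exact (dist_triangle _ _ _).trans (add_le_add h1 hyc)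
  refine ⟨M + D, K, A, hAc, inter_subset_left, fun n hn => ⟨?_, hZM n hn, hxlip n hn, hxA n hn,
    fun t ht => (hx n hn).traj_eq_integral hT hn hfint (hPZint n hn) ht⟩⟩
  filter_upwards [hPM n hn] with t ht
  linarith

end Sweeping

/-! ### Convergence of the algorithm -/

open Sweeping in
theorem mainTheorem3 {H : Type*} [NormedAddCommGroup H] [InnerProductSpace ℝ H] [CompleteSpace H]
    (T : ℝ) (hT : 0 < T)
    (C : Set H) (hC : Sweeping.IsBallCompact C) (x₀ : H) (hx₀ : x₀ ∈ C)
    (F : ℝ → H → Set H)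
    (hF_nonempty : ∀ t ∈ Icc 0 T, ∀ z, (F t z).Nonempty)
    (hF_closed : ∀ t ∈ Icc 0 T, ∀ z, IsClosed (F t z))
    (hF_convex : ∀ t ∈ Icc 0 T, ∀ z, Convex ℝ (F t z))
    (hF_usc : ∀ t ∈ Icc 0 T, Sweeping.IsWeaklyUSC (F t))
    (h : H → ℝ) (hh_nonneg : ∀ z, 0 ≤ h z) (L : ℝ≥0) (hh_lip : LipschitzWith L h)
    (hF_growth : ∀ z, ∀ᵐ t ∂(volume.restrict (Icc 0 T)), Metric.infDist 0 (F t z) ≤ h z)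
    (γ : ℝ) (hγ : 0 < γ) (f : ℝ → H → H)
    (hf_sel : ∀ t ∈ Icc 0 T, ∀ z, f t z ∈ Sweeping.epsProj (F t z) γ 0)
    (hf_meas : ∀ z, AEStronglyMeasurable (fun t => f t z) (volume.restrict (Icc 0 T)))
    (ε η : ℕ → ℝ) (hε : ∀ n, 1 ≤ n → 0 < ε n) (hη : ∀ n, 1 ≤ n → 0 < η n)
    (hε_lim : Tendsto (fun n : ℕ => ε n / (T / n) ^ 2) atTop (𝓝 0))
    (hη_lim : Tendsto (fun n : ℕ => η n / (T / n)) atTop (𝓝 0))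
    (y : ℕ → ℕ → H) (x : ℕ → ℝ → H)
    (hx : ∀ n, 1 ≤ n → Sweeping.IsInexactCatchingUp C f T x₀ (ε n) (η n) n (y n) (x n)) :
    ∃ (φ : ℕ → ℕ) (X : ℝ → H), StrictMono φ ∧
      TendstoUniformlyOn (fun j => x (φ j)) X atTop (Icc 0 T) ∧
      Sweeping.IsLipschitzSolution C F T x₀ X ∧
      ∀ᵐ t ∂(volume.restrict (Icc 0 T)), ‖deriv X t‖ ≤ 2 * (h (X t) + √γ) := by
  set ν : Measure ℝ := volume.restrict (Icc 0 T) with hν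
  set b : H → ℝ := fun z => h z + √γ with hbdef
  have hb : ∀ z, 0 ≤ b z := fun z => add_nonneg (hh_nonneg z) (Real.sqrt_nonneg γ)
  have hbL : LipschitzWith L b := by
    refine LipschitzWith.of_dist_le_mul fun u v => ?_
    simpa [b] using hh_lip.dist_le_mul u v
  have hfb : ∀ z, ∀ᵐ t ∂ν, ‖f t z‖ ≤ b z := by
    intro z
    filter_upwards [hF_growth z, ae_restrict_mem measurableSet_Icc] with t h1 h2
    exact norm_le_of_mem_epsProj (hf_sel t h2 z) hγ.le h1
  have hIoo : ∀ᵐ t ∂ν, t ∈ Ioo 0 T := by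
    rw [hν, ← Measure.restrict_congr_set Ioo_ae_eq_Icc]
    exact ae_restrict_mem measurableSet_Ioo
  have hμlim : Tendsto (fun n : ℕ => T / n) atTop (𝓝 0) := tendsto_const_div_atTop_nhds_zero_nat T
  have hηlim : Tendsto η atTop (𝓝 0) := by
    have h1 := hη_lim.mul hμlim
    rw [mul_zero] at h1
    refine h1.congr' ?_
    filter_upwards [eventually_ge_atTop 1] with n hn
    have : (0 : ℝ) < T / n := by positivity
    exact div_mul_cancel₀ _ this.ne'
  set δ : ℕ → ℝ := fun n => (η n + √(ε n)) / (T / n) with hδdef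
  have hδlim : Tendsto δ atTop (𝓝 0) := by
    have h1 := hη_lim.add hε_lim.sqrt
    rw [Real.sqrt_zero, add_zero] at h1
    refine h1.congr fun n => ?_
    rw [Real.sqrt_div' _ (sq_nonneg _), Real.sqrt_sq (by positivity), ← add_div]
  obtain ⟨M, K, A, hAc, hAC, hrun⟩ := exists_uniform_bounds hT hC hx₀ hb hbL hfb hf_meas hε hη
    hηlim hδlim hx
  have hxlip := fun n hn => (hrun n hn).2.2.1
  have hxA := fun n hn => (hrun n hn).2.2.2.1
  have hρ : Tendsto (fun n : ℕ => K * (T / n) + η n) atTop (𝓝 0) := by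
    simpa using (hμlim.const_mul (K : ℝ)).add hηlim
  -- The run with `0` steps is unconstrained, hence the shift of the index by one.
  obtain ⟨ψ, X, hψ, hlim⟩ := exists_tendstoUniformlyOn_of_lipschitz hT.le hAc
    (x := fun n => x (n + 1)) (fun n => hxlip (n + 1) (by omega))
    ((tendsto_add_atTop_iff_nat 1).2 hρ) (fun n => hxA (n + 1) (by omega))
  obtain ⟨m, hm⟩ : ∃ m : ℕ → ℕ, m = fun j => ψ j + 1 := ⟨_, rfl⟩
  have hmono : StrictMono m := by
    rw [hm]
    exact fun i j hij => Nat.add_lt_add_right (hψ hij) 1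
  have hm1 : ∀ j, 1 ≤ m j := by
    intro j
    rw [hm]
    simp
  have hmtop := hmono.tendsto_atTop
  replace hlim : TendstoUniformlyOn (fun j => x (m j)) X atTop (Icc 0 T) := by rwa [hm]
  have hpt : ∀ t ∈ Icc 0 T, Tendsto (fun j => x (m j) t) atTop (𝓝 (X t)) := fun t ht =>
    hlim.tendsto_at ht
  have hXC : ∀ t ∈ Icc 0 T, X t ∈ C := by
    intro t ht
    choose a haA had using fun j => hxA (m j) (hm1 j) t ht
    have h1 : Tendsto (fun j => x (m j) t - a j) atTop (𝓝 0) := by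
      refine squeeze_zero_norm (fun j => ?_) (hρ.comp hmtop)
      rw [← dist_eq_norm]
      exact had j
    have h2 : Tendsto a atTop (𝓝 (X t)) := by simpa using (hpt t ht).sub h1
    exact hAC (hAc.isClosed.mem_of_tendsto h2 (Eventually.of_forall haA))
  have hXlip : LipschitzOnWith K X (Icc 0 T) := by
    refine LipschitzOnWith.of_dist_le_mul fun t ht s hs => ?_
    exact le_of_tendsto ((hpt t ht).dist (hpt s hs))
      (Eventually.of_forall fun j => (hxlip (m j) (hm1 j)).dist_le_mul t ht s hs)
  have hX0 : X 0 = x₀ := by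
    refine tendsto_nhds_unique (hpt 0 ⟨le_rfl, hT.le⟩) ?_
    exact tendsto_const_nhds.congr fun j => (hx (m j) (hm1 j)).traj_zero.symm
  -- Perturbations and normal vectors are treated as one sequence of pairs, so that the same
  -- convex combinations serve both.
  have hder := ae_exists_mem_tailHull_hasDerivAt (E := WithLp 2 (H × H))
    (WithLp.fstL 2 ℝ H H - WithLp.sndL 2 ℝ H H) hT.le (X := X) (x₀ := x₀) (M := M + M)
    (g := fun j t => WithLp.toLp 2
      (pertStep f T (m j) (y (m j)) t, normalStep f T (m j) (y (m j)) t))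
    (fun j => (WithLp.prod_continuous_toLp 2 H H).comp_aestronglyMeasurable
      ((aestronglyMeasurable_pertStep hf_meas (m j) (y (m j))).prodMk
        (aestronglyMeasurable_normalStep f T (m j) (y (m j)) ν)))
    (fun j => by
      filter_upwards [(hrun (m j) (hm1 j)).1, hIoo] with t h1 h2
      exact (norm_toLp_prod_le _ _).trans
        (add_le_add h1 ((hrun (m j) (hm1 j)).2.1 t (Ioo_subset_Ioc_self h2))))
    (fun t ht => (hpt t ht).congr fun j =>
      (hrun (m j) (hm1 j)).2.2.2.2 t ht)
  have hmain : ∀ᵐ t ∂ν, (DifferentiableAt ℝ X t ∧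
      deriv X t ∈ -clarkeNormalCone C (X t) + F t (X t)) ∧ ‖deriv X t‖ ≤ 2 * b (X t) := by
    filter_upwards [hder, hIoo, ae_all_iff.2 fun j => ae_norm_pertStep_le hfb (m j) (y (m j))]
      with t ⟨p, hp, hpd⟩ ht hPt
    have htc : t ∈ Ioc 0 T := Ioo_subset_Ioc_self ht
    have hti : t ∈ Icc 0 T := Ioo_subset_Icc_self ht
    have hnode : ∀ k : ℕ → ℕ,
        (∀ j, dist (y (m j) (k j)) (x (m j) t) ≤ K * (T / (m j : ℕ))) →
        Tendsto (fun j => y (m j) (k j)) atTop (𝓝 (X t)) := by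
      intro k hk
      have h1 : Tendsto (fun j => y (m j) (k j) - x (m j) t) atTop (𝓝 0) := by
        refine squeeze_zero_norm (fun j => ?_)
          (by simpa using (hμlim.comp hmtop).const_mul (K : ℝ))
        rw [← dist_eq_norm]
        exact hk j
      simpa using h1.add (hpt t hti)
    -- Both the node that starts the current step, where the perturbation is evaluated, and the node
    -- that ends it, which is the approximate projection, tend to `X t`.
    have hy0 := hnode (fun j => stepIdx T (m j) t) fun j =>
      ((hx (m j) (hm1 j)).dist_node_le hT (hm1 j) (hxlip _ (hm1 j)) htc).1
    have hy1 := hnode (fun j => stepIdx T (m j) t + 1) fun j =>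
      ((hx (m j) (hm1 j)).dist_node_le hT (hm1 j) (hxlip _ (hm1 j)) htc).2
    have hp1 : p.fst ∈ tailHull fun j => pertStep f T (m j) (y (m j)) t := by
      have := map_mem_tailHull (WithLp.fstL 2 ℝ H H) hp
      exact this
    have hp2 : p.snd ∈ tailHull fun j => normalStep f T (m j) (y (m j)) t := by
      have := map_mem_tailHull (WithLp.sndL 2 ℝ H H) hp
      exact this
    have hp3 : p.fst - p.snd ∈ tailHull fun j =>
        pertStep f T (m j) (y (m j)) t - normalStep f T (m j) (y (m j)) t := by
      have := map_mem_tailHull (WithLp.fstL 2 ℝ H H - WithLp.sndL 2 ℝ H H) hp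
      exact this
    have hξ : p.fst ∈ F t (X t) :=
      mem_of_mem_tailHull_of_isWeaklyUSC (hF_usc t hti) (hF_closed t hti _) (hF_convex t hti _)
        hy0 (fun j => (hf_sel t hti _).1) hp1
    have hw : ∀ j, y (m j) (stepIdx T (m j) t + 1) ∈ epsEtaProj C (ε (m j)) (η (m j))
        (y (m j) (stepIdx T (m j) t) +
          ∫ s in (gridPt T (m j) (stepIdx T (m j) t))..(gridPt T (m j) (stepIdx T (m j) t + 1)),
            f s (y (m j) (stepIdx T (m j) t))) :=
      fun j => (hx (m j) (hm1 j)).node_succ _ (stepIdx_spec hT (hm1 j) htc).1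
    have hmpos : ∀ j, 0 < T / (m j : ℝ) := fun j => div_pos hT (Nat.cast_pos.2 (hm1 j))
    have hz : p.snd ∈ clarkeNormalCone C (X t) :=
      mem_clarkeNormalCone_of_mem_tailHull (hXC t hti) (fun j => hε (m j) (hm1 j))
        (fun j => (hη (m j) (hm1 j)).le) hmpos (hμlim.comp hmtop) (hε_lim.comp hmtop)
        (hη_lim.comp hmtop) hw hy1 (fun j => (hrun (m j) (hm1 j)).2.1 t htc) hp2
    have hdp : deriv X t = p.fst - p.snd := hpd.deriv
    refine ⟨⟨hpd.differentiableAt, ?_⟩, ?_⟩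
    · rw [hdp]
      refine ⟨-p.snd, by simpa using hz, p.fst, hξ, ?_⟩
      simp only
      abel
    · refine le_of_forall_pos_le_add fun a ha => ?_
      rw [hdp, ← mem_closedBall_zero_iff]
      refine mem_of_mem_tailHull hp3 (convex_closedBall _ _)
        Metric.isClosed_closedBall ?_
      have h1 : Tendsto (fun j => 2 * b (y (m j) (stepIdx T (m j) t)) + δ (m j)) atTop
          (𝓝 (2 * b (X t))) := by
        simpa using (((hbL.continuous.tendsto _).comp hy0).const_mul 2).add (hδlim.comp hmtop)
      filter_upwards [h1.eventually (gt_mem_nhds (lt_add_of_pos_right _ ha))] with j hj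
      rw [mem_closedBall_zero_iff]
      refine le_trans ?_ hj.le
      refine (norm_sub_le (pertStep f T (m j) (y (m j)) t)
        (normalStep f T (m j) (y (m j)) t)).trans ?_
      have hZj : ‖normalStep f T (m j) (y (m j)) t‖ ≤ b (y (m j) (stepIdx T (m j) t)) + δ (m j) :=
        (hx (m j) (hm1 j)).norm_normalStep_le hT (hm1 j) hx₀ (hη _ (hm1 j)).le (hε _ (hm1 j)).le
          hfb htc
      linarith [hPt j]
  refine ⟨m, X, hmono, hlim, ⟨⟨K, hXlip⟩, hX0, ?_⟩, ?_⟩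
  · filter_upwards [hmain] with t ht
    exact ht.1
  · filter_upwards [hmain] with t ht
    exact ht.2
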